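/- Let $\mathcal V=(Q,n,\delta)$ be a VASS: $Q$ is a nonempty finite set of control states, $n\ge 1$, and $\delta\subseteq Q\times\mathbb Z^n\times Q$ is finite. Let $(q,\mathbf x)\in Q\times\mathbb N^n$ be a configuration and $i\in\{1,\dots,n\}$. A finite run is a nonempty finite sequence of configurations in which each configuration $(p,\mathbf y)$ is followed by some $(p',\mathbf y+\mathbf b)$ with $(p,\mathbf b,p')\in\delta$ and $\mathbf y+\mathbf b\in\mathbb N^n$. The auxiliary VASS $\mathcal V_{rb}$ has dimension $2n$ and control states $Q\times\{\mathrm{DEC},\mathrm{INC}\}^n$. It has a transition $(p,\mathbf m)\xrightarrow{\mathbf b'}(p',\mathbf m')$ iff there is $(p,\mathbf b,p')\in\delta$ such that for every $j\in\{1,\dots,n\}$: $\mathbf b'(j)=\mathbf b(j)$; if $\mathbf b(j)<0$ then $\mathbf m'(j)=\mathrm{DEC}$; if $\mathbf b(j)>0$ then $\mathbf m'(j)=\mathrm{INC}$; if $\mathbf b(j)=0$ then $\mathbf m'(j)=\mathbf m(j)$; and $\mathbf b'(n+j)=1$ if $\mathbf m'(j)\ne\mathbf m(j)$ (a reversal),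 $\mathbf b'(n+j)=0$ otherwise. For $B\in\mathbb N$, the directed graph $TS_B$ on the configurations of $\mathcal V_{rb}$ is defined as the transition system of $\mathcal V_{rb}$, except that a reversal of component $j$ increments component $n+j$ only if the value of component $j$ just before the transition is greater than $B$ (and leaves component $n+j$ unchanged otherwise). Put $q_{rb}=(q,(\mathrm{INC},\dots,\mathrm{INC}))$ and $\mathbf x_{rb}=(\mathbf x,\mathbf 0)\in\mathbb N^{2n}$. The initialized VASS $(\mathcal V,(q,\mathbf x))$ is *weakly reversal-bounded with respect to $i$* if there is $B\ge 0$ such that the set of values $\mathbf y(n+i)$, over all $(q',\mathbf y)$ reachable from $(q_{rb},\mathbf x_{rb})$ in $TS_B$, is finite. A *disjointness sequence* (in dimension $2n$) is a nonempty sequence $\sigma=X_1\cdots X_K$ of nonempty, pairwise disjoint subsets of $\{1,\dots,2n\}$. A finite run satisfies $\mathrm{PB}_\sigma$ if it can be decomposed as $$(q_0,\mathbf x_0)\xrightarrow{*}(q_1,\mathbf x_1)\xrightarrow{*}(q_2,\mathbf x_2)\xrightarrow{*}\cdots\xrightarrow{*}(q_{2K-1},\mathbf x_{2K-1})\xrightarrow{*}(q_{2K},\mathbf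 x_{2K})$$ so that for every $l\in\{1,\dots,K\}$: $q_{2l-1}=q_{2l}$; $\mathbf x_{2l-1}(j)<\mathbf x_{2l}(j)$ for all $j\in X_l$; and for all $j\notin X_l$, $\mathbf x_{2l}(j)<\mathbf x_{2l-1}(j)$ implies $j\in X_1\cup\cdots\cup X_{l-1}$. **Lemma.** $(\mathcal V,(q,\mathbf x))$ is not weakly reversal-bounded with respect to $i$ if and only if there are a disjointness sequence $\sigma=X_1\cdots X_K$ with $n+i\in X_K$ and $i\in X_1\cup\cdots\cup X_{K-1}$ and a finite run of $\mathcal V_{rb}$ starting at $(q_{rb},\mathbf x_{rb})$ that satisfies $\mathrm{PB}_\sigma$. -/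

import Mathlib

/-- A vector addition system with states: a nonempty finite set `Q` of control states, a dimension
`n ≥ 1`, and a finite set of transitions `(q, b, q')` with `b ∈ ℤⁿ`. -/
structure VASS (Q : Type*) (n : ℕ) where
  states_finite : Finite Q
  states_nonempty : Nonempty Q
  one_le_dim : 1 ≤ n
  trans : Set (Q × (Fin n → ℤ) × Q)
  trans_finite : trans.Finite

namespace VASS

/-- Configurations: a control state and a vector of natural numbers. -/
abbrev Config (Q : Type*) (n : ℕ) := Q × (Fin n → ℕ)

/-- The one-step relation on configurations. -/
def Step {Q : Type*} {n : ℕ} (V : VASS Q n) (c c' : Config Q n) : Prop :=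
  ∃ b : Fin n → ℤ, (c.1, b, c'.1) ∈ V.trans ∧ ∀ j, (c'.2 j : ℤ) = (c.2 j : ℤ) + b j

/-- `ρ 0, …, ρ L` is a finite run. -/
def IsRun {Q : Type*} {n : ℕ} (V : VASS Q n) {L : ℕ} (ρ : Fin (L + 1) → Config Q n) : Prop :=
  ∀ k : Fin L, V.Step (ρ k.castSucc) (ρ k.succ)

/-- A disjointness sequence: a nonempty sequence of nonempty, pairwise disjoint sets of
components. -/
structure IsDisjointnessSeq {n K : ℕ} (σ : Fin K → Set (Fin n)) : Prop where
  length_pos : 0 < K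
  nonempty : ∀ l, (σ l).Nonempty
  disjoint : ∀ l l', l ≠ l' → Disjoint (σ l) (σ l')

/-- The position `2l - 1` of the start of the `l`-th distinguished segment, where `l ∈ [1, K]` is
represented by `l - 1 : Fin K`. -/
def startIdx {K : ℕ} (l : Fin K) : Fin (2 * K + 1) := ⟨2 * l.val + 1, by omega⟩

/-- The position `2l` of the end of the `l`-th distinguished segment. -/
def stopIdx {K : ℕ} (l : Fin K) : Fin (2 * K + 1) := ⟨2 * l.val + 2, by omega⟩

/-- The sequence of configurations `ρ` satisfies `PB_σ`: it can be cut at positions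
`0 = p 0 ≤ p 1 ≤ ⋯ ≤ p (2K) = L` in such a way that the configurations
`(q_k, x_k) = ρ (p k)` satisfy (P0), (STRICT) and (NONSTRICT). -/
def SatisfiesPB {Q : Type*} {n K L : ℕ} (σ : Fin K → Set (Fin n))
    (ρ : Fin (L + 1) → Config Q n) : Prop :=
  ∃ p : Fin (2 * K + 1) → Fin (L + 1),
    Monotone p ∧ p 0 = 0 ∧ p (Fin.last (2 * K)) = Fin.last L ∧
    (∀ l : Fin K, (ρ (p (startIdx l))).1 = (ρ (p (stopIdx l))).1) ∧
    (∀ l : Fin K, ∀ j ∈ σ l, (ρ (p (startIdx l))).2 j < (ρ (p (stopIdx l))).2 j) ∧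
    (∀ l : Fin K, ∀ j ∉ σ l, (ρ (p (stopIdx l))).2 j < (ρ (p (startIdx l))).2 j →
      ∃ l' < l, j ∈ σ l')

/-- The two modes of a counter. -/
inductive Mode where
  | DEC
  | INC

/-- The initial configuration `(q_rb, x_rb)`: all modes are `INC`, the first `n` components are
`x` and the last `n` components are `0`. -/
def rbInit {Q : Type*} {n : ℕ} (c : Config Q n) : Config (Q × (Fin n → Mode)) (n + n) :=
  ((c.1, fun _ => Mode.INC), Fin.append c.2 (fun _ => 0))

/-- How one transition with effect `b` on a counter updates its mode from `m` to `m'`, with `c` the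
effect on its reversal counter. -/
def RevCond (b : ℤ) (m m' : Mode) (c : ℤ) : Prop :=
  (b < 0 ∧ m = Mode.DEC ∧ m' = Mode.DEC ∧ c = 0) ∨
  (b < 0 ∧ m = Mode.INC ∧ m' = Mode.DEC ∧ c = 1) ∨
  (b > 0 ∧ m = Mode.INC ∧ m' = Mode.INC ∧ c = 0) ∨
  (b > 0 ∧ m = Mode.DEC ∧ m' = Mode.INC ∧ c = 1) ∨
  (b = 0 ∧ m = m' ∧ c = 0)

/-- The same update when a reversal is counted only if the current value `x` of the counter is
above `B`. -/
def WeakRevCond (B x : ℕ) (b : ℤ) (m m' : Mode) (c : ℤ) : Prop :=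
  (b < 0 ∧ m = Mode.DEC ∧ m' = Mode.DEC ∧ c = 0) ∨
  (b < 0 ∧ m = Mode.INC ∧ m' = Mode.DEC ∧ x ≤ B ∧ c = 0) ∨
  (b < 0 ∧ m = Mode.INC ∧ m' = Mode.DEC ∧ x > B ∧ c = 1) ∨
  (b > 0 ∧ m = Mode.INC ∧ m' = Mode.INC ∧ c = 0) ∨
  (b > 0 ∧ m = Mode.DEC ∧ m' = Mode.INC ∧ x > B ∧ c = 1) ∨
  (b > 0 ∧ m = Mode.DEC ∧ m' = Mode.INC ∧ x ≤ B ∧ c = 0) ∨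
  (b = 0 ∧ m = m' ∧ c = 0)

/-- The transitions of `V_rb`. Component `i` of `V` is component `Fin.castAdd n i` of `V_rb`, and
`Fin.natAdd n i` is the component `n + i`, which counts the reversals of `i`. -/
def rbTrans {Q : Type*} {n : ℕ} (V : VASS Q n) :
    Set ((Q × (Fin n → Mode)) × (Fin (n + n) → ℤ) × (Q × (Fin n → Mode))) :=
  {t | ∃ b : Fin n → ℤ, (t.1.1, b, t.2.2.1) ∈ V.trans ∧
    (∀ j, t.2.1 (Fin.castAdd n j) = b j) ∧
    ∀ j, RevCond (b j) (t.1.2 j) (t.2.2.2 j) (t.2.1 (Fin.natAdd n j))}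

theorem finite_mode : Finite Mode :=
  Finite.of_surjective (fun b : Bool => if b then Mode.INC else Mode.DEC) (by
    intro m
    cases m with
    | DEC => exact ⟨false, rfl⟩
    | INC => exact ⟨true, rfl⟩)

theorem rbTrans_finite {Q : Type*} {n : ℕ} (V : VASS Q n) : V.rbTrans.Finite := by
  have := finite_mode
  have hfin : (V.trans ×ˢ
      (Set.univ : Set ((Fin n → Mode) × (Fin n → Mode) × (Fin n → Bool)))).Finite :=
    V.trans_finite.prod Set.finite_univ
  refine (hfin.image (fun s => ((s.1.1, s.2.1),
    (Fin.append s.1.2.1 (fun j => if s.2.2.2 j then (1 : ℤ) else 0)),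
    (s.1.2.2, s.2.2.1)))).subset ?_
  rintro ⟨⟨q, m⟩, b', ⟨q', m'⟩⟩ ⟨b, hb, h1, h2⟩
  refine ⟨((q, b, q'), (m, m', fun j => decide (b' (Fin.natAdd n j) = 1))),
    ⟨hb, Set.mem_univ _⟩, ?_⟩
  simp only [Prod.mk.injEq, and_true, true_and]
  funext k
  refine Fin.addCases (fun j => ?_) (fun j => ?_) k
  · rw [Fin.append_left]
    exact (h1 j).symm
  · have h := h2 j
    simp only [RevCond] at h
    have h01 : b' (Fin.natAdd n j) = 0 ∨ b' (Fin.natAdd n j) = 1 := by tauto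
    rw [Fin.append_right]
    rcases h01 with h0 | h0 <;> simp only [h0] <;> decide

/-- The auxiliary VASS `V_rb` of dimension `2n`, with control states `Q × {DEC, INC}ⁿ`. -/
def rb {Q : Type*} {n : ℕ} (V : VASS Q n) : VASS (Q × (Fin n → Mode)) (n + n) where
  states_finite := by
    have := finite_mode
    have := V.states_finite
    infer_instance
  states_nonempty := by
    obtain ⟨q⟩ := V.states_nonempty
    exact ⟨(q, fun _ => Mode.INC)⟩
  one_le_dim := le_trans V.one_le_dim (Nat.le_add_left n n)
  trans := V.rbTrans
  trans_finite := V.rbTrans_finite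

/-- The one-step relation of the infinite directed graph `TS_B`. -/
def TSStep {Q : Type*} {n : ℕ} (V : VASS Q n) (B : ℕ)
    (c c' : Config (Q × (Fin n → Mode)) (n + n)) : Prop :=
  ∃ b' : Fin (n + n) → ℤ, ∃ b : Fin n → ℤ, (c.1.1, b, c'.1.1) ∈ V.trans ∧
    (∀ j, b' (Fin.castAdd n j) = b j) ∧
    (∀ j, WeakRevCond B (c.2 (Fin.castAdd n j)) (b j) (c.1.2 j) (c'.1.2 j)
      (b' (Fin.natAdd n j))) ∧
    ∀ k, (c'.2 k : ℤ) = (c.2 k : ℤ) + b' k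

/-- `(V, c)` is weakly reversal-bounded with respect to the component `i`: for some `B`, the
component `n + i` takes finitely many values on the vertices of `TS_B` that are reachable from
`(q_rb, x_rb)`. -/
def WeaklyReversalBoundedWrt {Q : Type*} {n : ℕ} (V : VASS Q n) (c : Config Q n)
    (i : Fin n) : Prop :=
  ∃ B : ℕ, {m : ℕ | ∃ d : Config (Q × (Fin n → Mode)) (n + n),
    Relation.ReflTransGen (V.TSStep B) (rbInit c) d ∧ d.2 (Fin.natAdd n i) = m}.Finite

end VASS

/-!
Both directions follow the Karp–Miller construction. A component that some loop strictly increases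
can be made as large as desired by repeating the loop, so it may be frozen, i.e. treated as
infinite, from then on; finitely many repetitions of each earlier loop turn a path with frozen
components back into a genuine run.

If the component `n + i` is unbounded in every `TS_B`, then for every `N` there is a path with `N`
reversals of `i`, each at a value above `N`. Take shortest such paths and a limit of them along an
ultrafilter. By Dickson's lemma the limit visits some `a` and later some `b` that covers `a`. If a
reversal in between belongs to the limit, it takes place above every `N`, so `i` is frozen, and this
loop is the last one of a disjointness sequence ending with `{n + i}`. Otherwise `a ≠ b`, since
the part in between could be cut out of the shortest paths; hence the loop increases a component
that is not yet frozen, and one freezes it and starts again from `b`. The components counting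
reversals never decrease and are frozen from the beginning, which keeps them out of all the earlier
loops.

Conversely, the loops before the last one make `i` so large that `N` repetitions of the last loop
stay above `B`, and each of them adds at least one counted reversal of `i`.
-/

namespace VASS

open Filter Relation

section Paths

variable {α : Type*} {r : α → α → Prop}

/-- The first `L` steps of the sequence `ρ` follow the relation `r`. -/
def IsPath (r : α → α → Prop) (ρ : ℕ → α) (L : ℕ) : Prop :=
  ∀ k < L, r (ρ k) (ρ (k + 1))

/-- The sequence that follows `ρ` up to time `m` and then continues with `τ`, whose first term
should be `ρ m`. -/
def splice (ρ : ℕ → α) (m : ℕ) (τ : ℕ → α) (k : ℕ) : α :=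
  if k ≤ m then ρ k else τ (k - m)

theorem splice_of_le {ρ τ : ℕ → α} {m k : ℕ} (h : k ≤ m) : splice ρ m τ k = ρ k :=
  if_pos h

theorem splice_add {ρ τ : ℕ → α} {m : ℕ} (h : ρ m = τ 0) (k : ℕ) :
    splice ρ m τ (m + k) = τ k := by
  cases k with
  | zero => rw [Nat.add_zero, splice_of_le le_rfl, h]
  | succ k => rw [splice, if_neg (by omega), Nat.add_sub_cancel_left]

theorem IsPath.append {ρ τ : ℕ → α} {m L : ℕ} (hρ : IsPath r ρ m) (hτ : IsPath r τ L)
    (h : ρ m = τ 0) : IsPath r (splice ρ m τ) (m + L) := by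
  intro k hk
  rcases lt_or_ge k m with hkm | hkm
  · rw [splice_of_le hkm.le, splice_of_le hkm]
    exact hρ k hkm
  · obtain ⟨d, rfl⟩ := Nat.exists_eq_add_of_le hkm
    rw [Nat.add_assoc, splice_add h, splice_add h]
    exact hτ d (by omega)

theorem IsPath.mono {ρ : ℕ → α} {m L : ℕ} (h : IsPath r ρ L) (hm : m ≤ L) : IsPath r ρ m :=
  fun k hk => h k (hk.trans_le hm)

theorem IsPath.drop {ρ : ℕ → α} {L : ℕ} (h : IsPath r ρ L) (m : ℕ) :
    IsPath r (fun k => ρ (m + k)) (L - m) :=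
  fun k hk => h (m + k) (by omega)

theorem IsPath.reflTransGen {ρ : ℕ → α} {L a b : ℕ} (h : IsPath r ρ L) (hab : a ≤ b)
    (hb : b ≤ L) : ReflTransGen r (ρ a) (ρ b) := by
  induction b, hab using Nat.le_induction with
  | base => exact .refl
  | succ b _ ih => exact (ih (by omega)).tail (h b hb)

theorem exists_isPath {x y : α} (h : ReflTransGen r x y) :
    ∃ (ρ : ℕ → α) (L : ℕ), IsPath r ρ L ∧ ρ 0 = x ∧ ρ L = y := by
  induction h with
  | refl => exact ⟨fun _ => x, 0, fun _ hk => absurd hk (Nat.not_lt_zero _), rfl, rfl⟩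
  | @tail b c _ hbc ih =>
    obtain ⟨ρ, L, hρ, h0, hL⟩ := ih
    refine ⟨Function.update ρ (L + 1) c, L + 1, fun k hk => ?_, ?_, Function.update_self ..⟩
    · rcases Nat.lt_succ_iff_lt_or_eq.1 hk with hk | rfl
      · rw [Function.update_of_ne (by omega), Function.update_of_ne (by omega)]
        exact hρ k hk
      · rwa [Function.update_of_ne (by omega), Function.update_self, hL]
    · rwa [Function.update_of_ne (by omega)]

theorem exists_isPath_through {d : ℕ → α} (h : ∀ k, ReflTransGen r (d k) (d (k + 1))) :
    ∃ p : ℕ → ℕ, Monotone p ∧ p 0 = 0 ∧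
      ∀ m, ∃ ρ : ℕ → α, IsPath r ρ (p m) ∧ ∀ k ≤ m, ρ (p k) = d k := by
  choose τ A hτ hτ0 hτA using fun k => exists_isPath (h k)
  obtain ⟨p, hp0, hp⟩ : ∃ p : ℕ → ℕ, p 0 = 0 ∧ ∀ k, p (k + 1) = p k + A k :=
    ⟨fun k => ∑ l ∈ Finset.range k, A l, rfl, Finset.sum_range_succ A⟩
  have hmono : Monotone p := monotone_nat_of_le_succ fun k => by simp only [hp, Nat.le_add_right]
  refine ⟨p, hmono, hp0, fun m => ?_⟩
  induction m with
  | zero =>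
    exact ⟨d, fun k hk => by omega, fun k hk => by rw [Nat.le_zero.1 hk, hp0]⟩
  | succ m ih =>
    obtain ⟨ρ, hρ, hd⟩ := ih
    have hm : ρ (p m) = τ m 0 := (hd m le_rfl).trans (hτ0 m).symm
    refine ⟨splice ρ (p m) (τ m), hp m ▸ hρ.append (hτ m) hm, fun k hk => ?_⟩
    rcases Nat.le_succ_iff.1 hk with hk | rfl
    · rw [splice_of_le (hmono hk), hd k hk]
    · rw [hp, splice_add hm, hτA]

theorem exists_eventually_eq {ι : Type*} (U : Ultrafilter ι) {ρ : ι → ℕ → α} {c : α}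
    (hfin : ∀ x, {y | r x y}.Finite) (h0 : ∀ N, ρ N 0 = c)
    (hr : ∀ k, ∀ᶠ N in (U : Filter ι), r (ρ N k) (ρ N (k + 1))) (k : ℕ) :
    ∃ x, ∀ᶠ N in (U : Filter ι), ρ N k = x := by
  induction k with
  | zero => exact ⟨c, .of_forall h0⟩
  | succ k ih =>
    obtain ⟨x, hx⟩ := ih
    have hsucc : ∀ᶠ N in (U : Filter ι), ∃ y ∈ {y | r x y}, ρ N (k + 1) = y := by
      filter_upwards [hx, hr k] with N hN hrN using ⟨_, hN ▸ hrN, rfl⟩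
    obtain ⟨y, -, hy⟩ := (Ultrafilter.eventually_exists_mem_iff (hfin x)).1 hsucc
    exact ⟨y, hy⟩

end Paths

section Rich

variable {α β : Type*} {r : α → α → Prop} {M : ℕ → α → α → Prop}

open Classical in
/-- The number of steps of `ρ`, among the first `L`, that are marked by `m`. -/
noncomputable def markCount (m : α → α → Prop) (ρ : ℕ → α) (L : ℕ) : ℕ :=
  Nat.count (fun k => m (ρ k) (ρ (k + 1))) L

theorem markCount_le (m : α → α → Prop) (ρ : ℕ → α) (L : ℕ) : markCount m ρ L ≤ L := by
  classical exact Nat.count_le _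

theorem markCount_add (m : α → α → Prop) (ρ : ℕ → α) (a b : ℕ) :
    markCount m ρ (a + b) = markCount m ρ a + markCount m (fun k => ρ (a + k)) b := by
  classical exact Nat.count_add ..

theorem markCount_mono {m : α → α → Prop} {m' : β → β → Prop} {ρ : ℕ → α} {τ : ℕ → β} {L : ℕ}
    (h : ∀ k < L, m (ρ k) (ρ (k + 1)) → m' (τ k) (τ (k + 1))) :
    markCount m ρ L ≤ markCount m' τ L := by
  classical
  simp only [markCount, Nat.count_eq_card_filter_range]
  exact Finset.card_le_card fun k hk => by
    simp only [Finset.mem_filter, Finset.mem_range] at hk ⊢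
    exact ⟨hk.1, h k hk.1 hk.2⟩

theorem markCount_eq_zero {m : α → α → Prop} {ρ : ℕ → α} {L : ℕ}
    (h : ∀ k < L, ¬ m (ρ k) (ρ (k + 1))) : markCount m ρ L = 0 := by
  classical exact Nat.count_iff_forall_not.2 h

theorem IsPath.le_add_markCount {m : α → α → Prop} {ρ : ℕ → α} {L : ℕ} (hρ : IsPath r ρ L)
    {f : α → ℕ} (hf : ∀ x y, r x y → f y ≤ f x + 1) (hm : ∀ x y, r x y → ¬ m x y → f y ≤ f x) :
    f (ρ L) ≤ f (ρ 0) + markCount m ρ L := by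
  classical
  induction L with
  | zero => exact Nat.le_add_right ..
  | succ L ih =>
    have ih := ih (hρ.mono L.le_succ)
    have hstep := hρ L L.lt_succ_self
    rw [markCount] at ih ⊢
    rw [Nat.count_succ]
    split_ifs with h
    · have := hf _ _ hstep
      omega
    · exact (hm _ _ hstep h).trans ih

/-- From `c` there are, for every `N`, paths with at least `N` steps that are marked by `M N`. -/
def Rich (r : α → α → Prop) (M : ℕ → α → α → Prop) (c : α) : Prop :=
  ∀ N, ∃ L ρ, ρ 0 = c ∧ IsPath r ρ L ∧ N ≤ markCount (M N) ρ L

theorem Rich.map {s : β → β → Prop} {M' : ℕ → β → β → Prop} {c : α} (f : α → β)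
    (hr : ∀ x y, r x y → s (f x) (f y)) (hM : ∀ N x y, M N x y → M' N (f x) (f y))
    (h : Rich r M c) : Rich s M' (f c) := fun N =>
  let ⟨L, ρ, h0, hρ, hN⟩ := h N
  ⟨L, f ∘ ρ, congrArg f h0, fun k hk => hr _ _ (hρ k hk),
    hN.trans (markCount_mono fun _ _ => hM N _ _)⟩

theorem IsPath.exists_shorter {m : α → α → Prop} {ρ : ℕ → α} {L a b : ℕ} (hρ : IsPath r ρ L)
    (hab : a < b) (hbL : b ≤ L) (heq : ρ a = ρ b)
    (hm : ∀ k, a ≤ k → k < b → ¬ m (ρ k) (ρ (k + 1))) :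
    ∃ L' < L, ∃ τ, τ 0 = ρ 0 ∧ IsPath r τ L' ∧ markCount m τ L' = markCount m ρ L := by
  obtain ⟨d, rfl⟩ := Nat.exists_eq_add_of_le hab.le
  obtain ⟨e, rfl⟩ := Nat.exists_eq_add_of_le hbL
  have hjoin : ρ a = (fun k => ρ (a + d + k)) 0 := heq
  refine ⟨a + e, by omega, splice ρ a fun k => ρ (a + d + k), splice_of_le (Nat.zero_le a), ?_, ?_⟩
  · exact (hρ.mono (by omega)).append ((hρ.drop (a + d)).mono (Nat.add_sub_cancel_left ..).ge) hjoin
  · have hcut : markCount m (fun k => ρ (a + k)) d = 0 :=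
      markCount_eq_zero fun k hk => hm (a + k) (by omega) (by omega)
    have hhead : markCount m (splice ρ a fun k => ρ (a + d + k)) a = markCount m ρ a :=
      le_antisymm
        (markCount_mono fun k hk => by rw [splice_of_le hk.le, splice_of_le hk]; exact id)
        (markCount_mono fun k hk => by rw [splice_of_le hk.le, splice_of_le hk]; exact id)
    rw [markCount_add, markCount_add m ρ (a + d), markCount_add m ρ a d, hcut, hhead]
    simp only [splice_add (τ := fun k => ρ (a + d + k)) hjoin, Nat.add_zero]

theorem Rich.exists_shortest {c : α} (h : Rich r M c) (N : ℕ) :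
    ∃ L ρ, ρ 0 = c ∧ IsPath r ρ L ∧ N ≤ markCount (M N) ρ L ∧
      ∀ a b, a < b → b ≤ L → ρ a = ρ b → ∃ k, a ≤ k ∧ k < b ∧ M N (ρ k) (ρ (k + 1)) := by
  classical
  obtain ⟨ρ, h0, hρ, hN⟩ := Nat.find_spec (h N)
  refine ⟨_, ρ, h0, hρ, hN, fun a b hab hb heq => ?_⟩
  by_contra! hm
  obtain ⟨L', hL', τ, hτ0, hτ, hcount⟩ := hρ.exists_shorter hab hb heq hm
  exact Nat.find_min (h N) hL' ⟨τ, hτ0.trans h0, hτ, hN.trans_eq hcount.symm⟩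

theorem Rich.of_suffixes {x : α} {b : ℕ} (hM : Antitone M)
    (h : ∀ K, ∃ N ≥ K, ∃ L ρ, ρ b = x ∧ IsPath r ρ L ∧ N ≤ markCount (M N) ρ L) :
    Rich r M x := fun K => by
  obtain ⟨N, hN, L, ρ, hx, hρ, hcount⟩ := h (K + b)
  have hbL : b + (L - b) = L := by
    have := hcount.trans (markCount_le _ ρ L)
    omega
  refine ⟨L - b, fun k => ρ (b + k), hx, hρ.drop b, ?_⟩
  rw [← hbL, markCount_add] at hcount
  have hhead := markCount_le (M N) ρ b
  have htail : markCount (M N) (fun k => ρ (b + k)) (L - b) ≤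
      markCount (M K) (fun k => ρ (b + k)) (L - b) :=
    markCount_mono fun k _ => hM (show K ≤ N by omega) _ _
  omega

/-- Some path from `a` to `b` has a step that is marked by `m`. -/
def ReachThrough (r m : α → α → Prop) (a b : α) : Prop :=
  ∃ u v, ReflTransGen r a u ∧ r u v ∧ m u v ∧ ReflTransGen r v b

theorem Rich.exists_loop {le : α → α → Prop} {c : α} (h : Rich r M c) (hM : Antitone M)
    (hfin : ∀ x, {y | r x y}.Finite) (hle : WellQuasiOrdered le) :
    ∃ a b, ReflTransGen r c a ∧ le a b ∧
      ((a ≠ b ∧ ReflTransGen r a b ∧ Rich r M b) ∨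
        ReachThrough r (fun u v => ∀ N, M N u v) a b) := by
  choose L ρ h0 hρ hcount hshort using h.exists_shortest
  let U := hyperfilter ℕ
  have hge (k : ℕ) : ∀ᶠ N in (U : Filter ℕ), k ≤ N :=
    Nat.hyperfilter_le_atTop (eventually_ge_atTop k)
  have hlen (N : ℕ) : N ≤ L N := (hcount N).trans (markCount_le ..)
  have hstep (k : ℕ) : ∀ᶠ N in (U : Filter ℕ), r (ρ N k) (ρ N (k + 1)) :=
    (hge (k + 1)).mono fun N hN => hρ N k (hN.trans (hlen N))
  choose σ hσ using exists_eventually_eq U hfin h0 hstep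
  have hσr (k : ℕ) : r (σ k) (σ (k + 1)) := by
    obtain ⟨N, h1, h2, h3⟩ := ((hσ k).and ((hσ (k + 1)).and (hstep k))).exists
    rwa [h1, h2] at h3
  have hreach {k l : ℕ} (hkl : k ≤ l) : ReflTransGen r (σ k) (σ l) :=
    IsPath.reflTransGen (fun k _ => hσr k) hkl le_rfl
  have hc : σ 0 = c := by
    obtain ⟨N, hN⟩ := (hσ 0).exists
    rw [← hN, h0]
  obtain ⟨a, b, hab, hle⟩ := hle σ
  refine ⟨σ a, σ b, hc ▸ hreach a.zero_le, hle, ?_⟩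
  by_cases hmark : ∃ k ∈ Set.Ico a b, ∀ᶠ N in (U : Filter ℕ), M N (σ k) (σ (k + 1))
  · obtain ⟨k, ⟨hak, hkb⟩, hk⟩ := hmark
    refine .inr ⟨σ k, σ (k + 1), hreach hak, hσr k, fun N => ?_, hreach hkb⟩
    obtain ⟨N', hN', hN⟩ := (hk.and (hge N)).exists
    exact hM hN _ _ hN'
  · refine .inl ⟨fun heq => ?_, hreach hab.le, Rich.of_suffixes (b := b) hM fun K => ?_⟩
    · refine hmark ((Ultrafilter.eventually_exists_mem_iff (Set.finite_Ico a b)).1 ?_)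
      have hprefix : ∀ᶠ N in (U : Filter ℕ), ∀ k ∈ Set.Iic b, ρ N k = σ k :=
        (eventually_all_finite (Set.finite_Iic b)).2 fun k _ => hσ k
      filter_upwards [hprefix, hge b] with N hN hbN
      obtain ⟨k, hak, hkb, hk⟩ := hshort N a b hab (hbN.trans (hlen N))
        (by rw [hN a hab.le, hN b Set.self_mem_Iic, heq])
      exact ⟨k, ⟨hak, hkb⟩, by rwa [hN k hkb.le, hN (k + 1) hkb] at hk⟩
    · obtain ⟨N, hN, hKN⟩ := ((hσ b).and (hge K)).exists
      exact ⟨N, hKN, L N, ρ N, hN, hρ N, hcount N⟩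

end Rich

section Acceleration

variable {P : Type*} {n : ℕ} {W : VASS P n} {S S' C Y : Set (Fin n)} {c₀ c c' a b : Config P n}

/-- The covering order: same control state, and componentwise larger vector. -/
def CoveredBy (a b : Config P n) : Prop :=
  a.1 = b.1 ∧ a.2 ≤ b.2

theorem wellQuasiOrdered_coveredBy (W : VASS P n) :
    WellQuasiOrdered (CoveredBy : Config P n → Config P n → Prop) :=
  have := W.states_finite
  (Finite.wellQuasiOrdered (· = ·)).prod wellQuasiOrdered_le

/-- The one-step relation in which the components in `S` are left unchanged and do not have to
stay nonnegative. -/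
def FrozenStep (W : VASS P n) (S : Set (Fin n)) (c c' : Config P n) : Prop :=
  ∃ b : Fin n → ℤ, (c.1, b, c'.1) ∈ W.trans ∧ (∀ j ∉ S, (c'.2 j : ℤ) = (c.2 j : ℤ) + b j) ∧
    ∀ j ∈ S, c'.2 j = c.2 j

/-- Reset the components in `S` to zero. -/
noncomputable def freeze (S : Set (Fin n)) (c : Config P n) : Config P n :=
  (c.1, Sᶜ.indicator c.2)

theorem freeze_of_mem {j : Fin n} (hj : j ∈ S) (c : Config P n) : (freeze S c).2 j = 0 :=
  Set.indicator_of_notMem (Set.notMem_compl_iff.2 hj) _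

theorem freeze_of_notMem {j : Fin n} (hj : j ∉ S) (c : Config P n) : (freeze S c).2 j = c.2 j :=
  Set.indicator_of_mem (Set.mem_compl hj) _

theorem freeze_eq_freeze_iff :
    freeze S c = freeze S c' ↔ c.1 = c'.1 ∧ ∀ j ∉ S, c.2 j = c'.2 j := by
  refine Prod.ext_iff.trans
    (and_congr_right fun _ => ⟨fun h j hj => ?_, fun h => funext fun j => ?_⟩)
  · rw [← freeze_of_notMem hj, h, freeze_of_notMem hj]
  · by_cases hj : j ∈ S
    · rw [freeze_of_mem hj, freeze_of_mem hj]
    · rw [freeze_of_notMem hj, freeze_of_notMem hj, h j hj]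

theorem freeze_freeze (h : S ⊆ S') (c : Config P n) : freeze S' (freeze S c) = freeze S' c :=
  freeze_eq_freeze_iff.2 ⟨rfl, fun _ hj => freeze_of_notMem (fun hS => hj (h hS)) c⟩

theorem frozenStep_freeze_iff : W.FrozenStep S (freeze S c) (freeze S c') ↔
    ∃ b : Fin n → ℤ, (c.1, b, c'.1) ∈ W.trans ∧ ∀ j ∉ S, (c'.2 j : ℤ) = (c.2 j : ℤ) + b j := by
  refine exists_congr fun b => and_congr_right fun _ => ⟨fun h j hj => ?_, fun h => ⟨fun j hj => ?_,
    fun j hj => ?_⟩⟩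
  · rw [← freeze_of_notMem hj, ← freeze_of_notMem hj c]
    exact h.1 j hj
  · rw [freeze_of_notMem hj, freeze_of_notMem hj]
    exact h j hj
  · rw [freeze_of_mem hj, freeze_of_mem hj]

theorem FrozenStep.freeze (h : W.FrozenStep S c c') (hS : S ⊆ S') :
    W.FrozenStep S' (freeze S' c) (freeze S' c') :=
  let ⟨b, hb, h1, _⟩ := h
  frozenStep_freeze_iff.2 ⟨b, hb, fun j hj => h1 j fun hj' => hj (hS hj')⟩

theorem Step.freeze (h : W.Step c c') (S : Set (Fin n)) :
    W.FrozenStep S (freeze S c) (freeze S c') :=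
  let ⟨b, hb, h1⟩ := h
  frozenStep_freeze_iff.2 ⟨b, hb, fun j _ => h1 j⟩

theorem reach_freeze (h : ReflTransGen W.Step c c') (S : Set (Fin n)) :
    ReflTransGen (W.FrozenStep S) (freeze S c) (freeze S c') :=
  h.lift _ fun _ _ h => h.freeze S

theorem coveredBy_freeze (hst : a.1 = b.1) (hle : ∀ j ∉ S, a.2 j ≤ b.2 j) :
    CoveredBy (freeze S a) (freeze S b) := by
  refine ⟨hst, fun j => ?_⟩
  by_cases hj : j ∈ S
  · rw [freeze_of_mem hj, freeze_of_mem hj]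
  · rw [freeze_of_notMem hj, freeze_of_notMem hj]
    exact hle j hj

theorem finite_setOf_frozenStep (W : VASS P n) (S : Set (Fin n)) (c : Config P n) :
    {c' | W.FrozenStep S c c'}.Finite := by
  classical
  refine (W.trans_finite.image fun t =>
    (t.2.2, fun j => if j ∈ S then c.2 j else ((c.2 j : ℤ) + t.2.1 j).toNat)).subset ?_
  rintro ⟨p, y⟩ ⟨b, hb, h1, h2⟩
  refine ⟨_, hb, Prod.ext rfl (funext fun j => ?_)⟩
  by_cases hj : j ∈ S
  · simpa only [if_pos hj] using (h2 j hj).symm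
  · simp only [if_neg hj, ← h1 j hj, Int.toNat_natCast]

theorem eq_of_reflTransGen_frozenStep (h : ReflTransGen (W.FrozenStep S) c c') {j : Fin n}
    (hj : j ∈ S) : c'.2 j = c.2 j := by
  induction h with
  | refl => rfl
  | tail _ h ih =>
    obtain ⟨_, _, _, h⟩ := h
    rw [h j hj, ih]

/-- Configurations obtained from `c₀` by runs and nondecreasing loops, where the components in `C`
are frozen from the beginning and those increased by a loop are frozen from then on. -/
inductive Accelerated (W : VASS P n) (C : Set (Fin n)) (c₀ : Config P n) :
    Set (Fin n) → Config P n → Prop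
  | init : Accelerated W C c₀ C (freeze C c₀)
  | loop {S Y : Set (Fin n)} {c a b : Config P n} : Accelerated W C c₀ S c →
      ReflTransGen (W.FrozenStep S) c a → ReflTransGen (W.FrozenStep S) a b → CoveredBy a b →
      Y.Nonempty → (∀ j ∈ Y, a.2 j < b.2 j) → Accelerated W C c₀ (S ∪ Y) (freeze (S ∪ Y) b)

theorem Accelerated.subset (h : W.Accelerated C c₀ S c) : C ⊆ S := by
  induction h with
  | init => exact subset_rfl
  | loop _ _ _ _ _ _ ih => exact ih.trans Set.subset_union_left

theorem disjoint_of_forall_lt (h : ReflTransGen (W.FrozenStep S) a b)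
    (hY : ∀ j ∈ Y, a.2 j < b.2 j) : Disjoint S Y :=
  Set.disjoint_left.2 fun j hS hj => (hY j hj).ne' (eq_of_reflTransGen_frozenStep h hS)

/-- A step whose control states are related by `R` and which starts with a value of `i` above `N`,
a frozen component counting as infinite. -/
def HighMark (R : P → P → Prop) (i : Fin n) (S : Set (Fin n)) (N : ℕ) (u v : Config P n) : Prop :=
  R u.1 v.1 ∧ (i ∈ S ∨ N < u.2 i)

variable {R : P → P → Prop} {i : Fin n}

theorem antitone_highMark : Antitone (HighMark R i S) :=
  fun _ _ hN _ _ h => ⟨h.1, h.2.imp_right hN.trans_lt⟩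

theorem Rich.freeze (h : Rich (W.FrozenStep S) (HighMark R i S) c) (hS : S ⊆ S') :
    Rich (W.FrozenStep S') (HighMark R i S') (freeze S' c) :=
  h.map (VASS.freeze S') (fun _ _ h => h.freeze hS) fun N u v ⟨hR, hi⟩ => ⟨hR, by
    by_cases hi' : i ∈ S'
    · exact .inl hi'
    · rw [freeze_of_notMem hi']
      exact .inr (hi.resolve_left fun hiS => hi' (hS hiS))⟩

theorem Accelerated.exists_loop (hc : W.Accelerated C c₀ S c)
    (h : Rich (W.FrozenStep S) (HighMark R i S) c) :
    ∃ S c a b, W.Accelerated C c₀ S c ∧ i ∈ S ∧ ReflTransGen (W.FrozenStep S) c a ∧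
      CoveredBy a b ∧ ReachThrough (W.FrozenStep S) (fun u v => R u.1 v.1) a b := by
  induction hm : Sᶜ.ncard using Nat.strong_induction_on generalizing S c with
  | _ m ih =>
    obtain ⟨a, b, hca, hle, ⟨hne, hab, hb⟩ | ⟨u, v, hau, huv, hmark, hvb⟩⟩ :=
      h.exists_loop antitone_highMark (W.finite_setOf_frozenStep S) (wellQuasiOrdered_coveredBy W)
    · obtain ⟨j, hj⟩ : ∃ j, a.2 j < b.2 j :=
        (Pi.lt_def.1 (lt_of_le_of_ne hle.2 fun heq => hne (Prod.ext hle.1 heq))).2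
      have hjS : j ∉ S := fun hjS => hj.ne' (eq_of_reflTransGen_frozenStep hab hjS)
      have hlt : (S ∪ {j})ᶜ.ncard < m := by
        rw [← hm]
        refine Set.ncard_lt_ncard (compl_lt_compl_iff_lt.2 ?_) (Set.toFinite _)
        exact Set.union_singleton ▸ Set.ssubset_insert hjS
      exact ih _ hlt (hc.loop hca hab hle (Set.singleton_nonempty j) (by rintro _ rfl; exact hj))
        (hb.freeze Set.subset_union_left) rfl
    · have hi : i ∈ S := (hmark (u.2 i)).2.resolve_right (lt_irrefl _)
      exact ⟨S, c, a, b, hc, hi, hca, hle, u, v, hau, huv, (hmark 0).1, hvb⟩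

end Acceleration

section Lifting

variable {P : Type*} {n : ℕ} {W : VASS P n} {S C Y : Set (Fin n)} {c c' a b z z' : Config P n}

/-- `z` has the same state as `c`, is above `c` outside `S`, and is above `T` on the components of
`S` other than those of `C`, which are unconstrained. -/
def Above (C S : Set (Fin n)) (T : ℕ) (c z : Config P n) : Prop :=
  z.1 = c.1 ∧ (∀ j ∉ S, c.2 j ≤ z.2 j) ∧ ∀ j ∈ S \ C, T ≤ z.2 j

theorem Above.mono {T T' : ℕ} (h : Above C S T c z) (hT : T' ≤ T) : Above C S T' c z :=
  ⟨h.1, h.2.1, fun j hj => hT.trans (h.2.2 j hj)⟩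

theorem Above.of_coveredBy {T : ℕ} (h : Above C S T b z) (hab : CoveredBy a b) :
    Above C S T a z :=
  ⟨h.1.trans hab.1.symm, fun j hj => (hab.2 j).trans (h.2.1 j hj), h.2.2⟩

theorem Above.freeze {T : ℕ} (h : Above C S T c z) : Above C S T (freeze S c) z :=
  ⟨h.1, fun j hj => (freeze_of_notMem hj c).trans_le (h.2.1 j hj), h.2.2⟩

/-- No transition decreases a component in `C`. -/
def IsNondecreasing (W : VASS P n) (C : Set (Fin n)) : Prop :=
  ∀ t ∈ W.trans, ∀ j ∈ C, 0 ≤ t.2.1 j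

theorem IsNondecreasing.le_of_reach (hC : W.IsNondecreasing C) (h : ReflTransGen W.Step z z')
    {j : Fin n} (hj : j ∈ C) : z.2 j ≤ z'.2 j := by
  induction h with
  | refl => exact le_rfl
  | tail _ h ih =>
    obtain ⟨b, hb, h⟩ := h
    have := h j
    have := hC _ hb j hj
    simp only at this
    omega

/-- A step taken from a configuration that is above `T` on `D`. -/
def HighStep (W : VASS P n) (D : Set (Fin n)) (T : ℕ) (z z' : Config P n) : Prop :=
  W.Step z z' ∧ ∀ j ∈ D, T ≤ z.2 j

theorem HighStep.mono {D D' : Set (Fin n)} {T T' : ℕ} (h : W.HighStep D T z z') (hD : D' ⊆ D)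
    (hT : T' ≤ T) : W.HighStep D' T' z z' :=
  ⟨h.1, fun j hj => hT.trans (h.2 j (hD hj))⟩

theorem reach_of_highStep {D : Set (Fin n)} {T : ℕ} (h : ReflTransGen (W.HighStep D T) z z') :
    ReflTransGen W.Step z z' :=
  ReflTransGen.mono (fun _ _ h => h.1) _ _ h

theorem FrozenStep.exists_highStep (h : W.FrozenStep S c c') (hC : W.IsNondecreasing C) (T : ℕ) :
    ∃ T', ∀ z, Above C S T' c z → ∃ z', W.HighStep (S \ C) T z z' ∧ Above C S T c' z' ∧
      ∀ j ∉ S, z'.2 j + c.2 j = z.2 j + c'.2 j := by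
  obtain ⟨b, hb, hbS, -⟩ := h
  refine ⟨T + ∑ j, (b j).natAbs, fun z ⟨hz, hzc, hzT⟩ => ?_⟩
  have habs (j : Fin n) : (b j).natAbs ≤ ∑ j, (b j).natAbs :=
    Finset.single_le_sum (f := fun j => (b j).natAbs) (fun _ _ => Nat.zero_le _)
      (Finset.mem_univ j)
  have hhigh : ∀ j ∈ S \ C, (T : ℤ) ≤ (z.2 j : ℤ) + b j := fun j hj => by
    have := hzT j hj
    have := habs j
    omega
  have hnonneg (j : Fin n) : 0 ≤ (z.2 j : ℤ) + b j := by
    by_cases hjS : j ∈ S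
    · by_cases hjC : j ∈ C
      · exact add_nonneg (Int.natCast_nonneg _) (hC _ hb j hjC)
      · exact (Int.natCast_nonneg T).trans (hhigh j ⟨hjS, hjC⟩)
    · have := hbS j hjS
      have := hzc j hjS
      omega
  obtain ⟨y, hy⟩ : ∃ y : Fin n → ℕ, ∀ j, (y j : ℤ) = (z.2 j : ℤ) + b j :=
    ⟨fun j => ((z.2 j : ℤ) + b j).toNat, fun j => Int.toNat_of_nonneg (hnonneg j)⟩
  have hdrift : ∀ j ∉ S, y j + c.2 j = z.2 j + c'.2 j := fun j hj => by
    have := hbS j hj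
    have := hy j
    omega
  refine ⟨(c'.1, y), ⟨⟨b, hz ▸ hb, hy⟩, fun j hj => (Nat.le_add_right ..).trans (hzT j hj)⟩,
    ⟨rfl, fun j hj => ?_, fun j hj => ?_⟩, hdrift⟩
  · have := hdrift j hj
    have := hzc j hj
    change c'.2 j ≤ y j
    omega
  · exact Int.ofNat_le.1 (hy j ▸ hhigh j hj)

theorem exists_highSteps (h : ReflTransGen (W.FrozenStep S) c c') (hC : W.IsNondecreasing C)
    (T : ℕ) :
    ∃ T', ∀ z, Above C S T' c z → ∃ z', ReflTransGen (W.HighStep (S \ C) T) z z' ∧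
      Above C S T c' z' ∧ ∀ j ∉ S, z'.2 j + c.2 j = z.2 j + c'.2 j := by
  induction h generalizing T with
  | refl => exact ⟨T, fun z hz => ⟨z, .refl, hz, fun _ _ => rfl⟩⟩
  | tail _ h ih =>
    obtain ⟨T₁, hT₁⟩ := h.exists_highStep hC T
    obtain ⟨T₂, hT₂⟩ := ih (max T T₁)
    refine ⟨T₂, fun z hz => ?_⟩
    obtain ⟨y, hzy, hy, hdrift⟩ := hT₂ z hz
    obtain ⟨w, hyw, hw, hdrift'⟩ := hT₁ y (hy.mono (le_max_right ..))
    have hzy := ReflTransGen.mono (fun _ _ h => h.mono subset_rfl (le_max_left ..)) _ _ hzy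
    refine ⟨w, hzy.tail hyw, hw, fun j hj => ?_⟩
    have := hdrift j hj
    have := hdrift' j hj
    omega

theorem exists_highSteps_iterate (h : ReflTransGen (W.FrozenStep S) a b) (hab : CoveredBy a b)
    (hC : W.IsNondecreasing C) (m T : ℕ) :
    ∃ T', ∀ z, Above C S T' a z → ∃ z', ReflTransGen (W.HighStep (S \ C) T) z z' ∧
      Above C S T a z' ∧ ∀ j ∉ S, z'.2 j + m * a.2 j = z.2 j + m * b.2 j := by
  induction m with
  | zero => exact ⟨T, fun z hz => ⟨z, .refl, hz, fun _ _ => by simp only [zero_mul]⟩⟩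
  | succ m ih =>
    obtain ⟨T₁, hT₁⟩ := ih
    obtain ⟨T₂, hT₂⟩ := exists_highSteps h hC (max T T₁)
    refine ⟨T₂, fun z hz => ?_⟩
    obtain ⟨y, hzy, hy, hdrift⟩ := hT₂ z hz
    obtain ⟨w, hyw, hw, hdrift'⟩ := hT₁ y ((hy.mono (le_max_right ..)).of_coveredBy hab)
    have hzy := ReflTransGen.mono (fun _ _ h => h.mono subset_rfl (le_max_left ..)) _ _ hzy
    refine ⟨w, hzy.trans hyw, hw, fun j hj => ?_⟩
    have := hdrift j hj
    have := hdrift' j hj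
    rw [Nat.succ_mul, Nat.succ_mul]
    omega

theorem exists_pumped_loop (h : ReflTransGen (W.FrozenStep S) a b) (hab : CoveredBy a b)
    (hY : ∀ j ∈ Y, a.2 j < b.2 j) (hC : W.IsNondecreasing C) (T : ℕ) :
    ∃ T', ∀ z, Above C S T' a z → ∃ z₁ z₂, ReflTransGen W.Step z z₁ ∧ ReflTransGen W.Step z₁ z₂ ∧
      z₁.1 = z₂.1 ∧ (∀ j ∉ S, z₁.2 j ≤ z₂.2 j) ∧ (∀ j ∈ Y, z₁.2 j < z₂.2 j) ∧
      Above C (S ∪ Y) T b z₂ := by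
  have hSY : ∀ j ∈ Y, j ∉ S := fun j hj hjS =>
    Set.disjoint_left.1 (disjoint_of_forall_lt h hY) hjS hj
  obtain ⟨T₁, hT₁⟩ := exists_highSteps h hC T
  obtain ⟨T₂, hT₂⟩ := exists_highSteps_iterate h hab hC T T₁
  refine ⟨T₂, fun z hz => ?_⟩
  obtain ⟨z₁, hzz₁, hz₁, hpump⟩ := hT₂ z hz
  obtain ⟨z₂, hz₁z₂, hz₂, hdrift⟩ := hT₁ z₁ hz₁
  have hlt : ∀ j ∈ Y, z₁.2 j < z₂.2 j := fun j hj => by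
    have := hdrift j (hSY j hj)
    have := hY j hj
    omega
  have hbig : ∀ j ∈ Y, T ≤ z₁.2 j := fun j hj => by
    have := hpump j (hSY j hj)
    have : T * (a.2 j + 1) ≤ T * b.2 j := Nat.mul_le_mul_left T (hY j hj)
    rw [Nat.mul_succ] at this
    omega
  refine ⟨z₁, z₂, reach_of_highStep hzz₁, reach_of_highStep hz₁z₂,
    hz₁.1.trans (hab.1.trans hz₂.1.symm), fun j hj => ?_, hlt,
    hz₂.1, fun j hj => hz₂.2.1 j fun hjS => hj (.inl hjS), ?_⟩
  · have := hdrift j hj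
    have : a.2 j ≤ b.2 j := hab.2 j
    omega
  · rintro j ⟨hjS | hjY, hjC⟩
    · exact hz₂.2.2 j ⟨hjS, hjC⟩
    · exact (hbig j hjY).trans (hlt j hjY).le

end Lifting

section LoopChains

variable {P : Type*} {n K : ℕ} {W : VASS P n} {S C Y : Set (Fin n)} {X : Fin K → Set (Fin n)}
  {c₀ c a b z : Config P n}

/-- The final configurations of the runs from `c₀` that satisfy `PB` for a sequence `X` of
nonempty and pairwise disjoint sets. Unlike in `IsDisjointnessSeq`, `X` may be empty. -/
inductive LoopChain (W : VASS P n) (c₀ : Config P n) :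
    {K : ℕ} → (Fin K → Set (Fin n)) → Config P n → Prop
  | nil (X : Fin 0 → Set (Fin n)) : LoopChain W c₀ X c₀
  | loop {K : ℕ} {X : Fin K → Set (Fin n)} {Y : Set (Fin n)} {c a b : Config P n} :
      LoopChain W c₀ X c → ReflTransGen W.Step c a → ReflTransGen W.Step a b → a.1 = b.1 →
      Y.Nonempty → (∀ l, Disjoint (X l) Y) → (∀ j ∈ Y, a.2 j < b.2 j) →
      (∀ j ∉ Y, b.2 j < a.2 j → ∃ l, j ∈ X l) →
      LoopChain W c₀ (Fin.snoc X Y : Fin (K + 1) → Set (Fin n)) b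

theorem LoopChain.reach (h : W.LoopChain c₀ X c) : ReflTransGen W.Step c₀ c := by
  induction h with
  | nil => exact .refl
  | loop _ hca hab _ _ _ _ _ ih => exact (ih.trans hca).trans hab

theorem iUnion_snoc (X : Fin K → Set (Fin n)) (Y : Set (Fin n)) :
    ⋃ l, (Fin.snoc X Y : Fin (K + 1) → Set (Fin n)) l = (⋃ l, X l) ∪ Y := by
  ext j
  simp only [Set.mem_iUnion, Set.mem_union, Fin.exists_fin_succ', Fin.snoc_castSucc, Fin.snoc_last]

theorem LoopChain.loop_of_iUnion_eq (h : W.LoopChain c₀ X c) (hC : W.IsNondecreasing C)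
    (hX : ⋃ l, X l = S \ C) (hca : ReflTransGen W.Step c a) (hab : ReflTransGen W.Step a b)
    (hst : a.1 = b.1) (hY : Y.Nonempty) (hYS : Disjoint (S \ C) Y) (hlt : ∀ j ∈ Y, a.2 j < b.2 j)
    (hle : ∀ j ∉ S, a.2 j ≤ b.2 j) :
    W.LoopChain c₀ (Fin.snoc X Y : Fin (K + 1) → Set (Fin n)) b := by
  refine h.loop hca hab hst hY (fun l => hYS.mono_left (hX ▸ Set.subset_iUnion X l)) hlt
    fun j _ hj => Set.mem_iUnion.1 (hX ▸ ⟨?_, fun hjC => ?_⟩)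
  · by_contra hjS
    exact (hle j hjS).not_gt hj
  · exact (hC.le_of_reach hab hjC).not_gt hj

theorem Accelerated.exists_loopChain (h : W.Accelerated C c₀ S c) (hC : W.IsNondecreasing C)
    (T : ℕ) :
    ∃ (K : ℕ) (X : Fin K → Set (Fin n)) (z : Config P n),
      W.LoopChain c₀ X z ∧ ⋃ l, X l = S \ C ∧ Above C S T c z := by
  induction h generalizing T with
  | init =>
    refine ⟨0, Fin.elim0, c₀, .nil _, by simp, rfl, fun j hj => (freeze_of_notMem hj c₀).le, ?_⟩
    simp
  | @loop S Y c a b hc hca hab hle hY hlt ih =>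
    obtain ⟨T₁, hT₁⟩ := exists_pumped_loop hab hle hlt hC T
    obtain ⟨T₂, hT₂⟩ := exists_highSteps hca hC T₁
    obtain ⟨K, X, z, hz, hX, hzc⟩ := ih T₂
    obtain ⟨z₀, hzz₀, hz₀, -⟩ := hT₂ z hzc
    obtain ⟨z₁, z₂, hz₀z₁, hz₁z₂, hst, hle', hlt', hz₂⟩ := hT₁ z₀ hz₀
    have hSY : Disjoint S Y := disjoint_of_forall_lt hab hlt
    refine ⟨K + 1, Fin.snoc X Y, z₂, hz.loop_of_iUnion_eq hC hX
      ((reach_of_highStep hzz₀).trans hz₀z₁) hz₁z₂ hst hY (hSY.mono_left Set.sdiff_subset)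
      hlt' hle', ?_, hz₂.freeze⟩
    rw [iUnion_snoc, hX, Set.union_sdiff_distrib, (hSY.mono_left hc.subset).sdiff_eq_right]

theorem Accelerated.exists_loopChain_snoc {R : P → P → Prop} {k : Fin n}
    (h : W.Accelerated C c₀ S c) (hC : W.IsNondecreasing C) (hk : k ∈ C)
    (hR : ∀ z z', W.Step z z' → R z.1 z'.1 → z.2 k < z'.2 k)
    (hca : ReflTransGen (W.FrozenStep S) c a) (hle : CoveredBy a b)
    (hab : ReachThrough (W.FrozenStep S) (fun u v => R u.1 v.1) a b) :
    ∃ (K : ℕ) (X : Fin K → Set (Fin n)) (z : Config P n), ⋃ l, X l = S \ C ∧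
      W.LoopChain c₀ (Fin.snoc X {k} : Fin (K + 1) → Set (Fin n)) z := by
  obtain ⟨u, v, hau, huv, hRuv, hvb⟩ := hab
  obtain ⟨T₁, hT₁⟩ := exists_highSteps hvb hC 0
  obtain ⟨T₂, hT₂⟩ := huv.exists_highStep hC T₁
  obtain ⟨T₃, hT₃⟩ := exists_highSteps hau hC T₂
  obtain ⟨T₄, hT₄⟩ := exists_highSteps hca hC T₃
  obtain ⟨K, X, z, hz, hX, hzc⟩ := h.exists_loopChain hC T₄
  obtain ⟨za, hzza, hza, -⟩ := hT₄ z hzc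
  obtain ⟨zu, hzau, hzu, hdriftu⟩ := hT₃ za hza
  obtain ⟨zv, ⟨hzuv, -⟩, hzv, hdriftv⟩ := hT₂ zu hzu
  obtain ⟨zb, hzvb, hzb, hdriftb⟩ := hT₁ zv hzv
  have hlt : za.2 k < zb.2 k := calc
    za.2 k ≤ zu.2 k := hC.le_of_reach (reach_of_highStep hzau) hk
    _ < zv.2 k := hR zu zv hzuv (by rwa [hzu.1, hzv.1])
    _ ≤ zb.2 k := hC.le_of_reach (reach_of_highStep hzvb) hk
  refine ⟨K, X, zb, hX, hz.loop_of_iUnion_eq hC hX (reach_of_highStep hzza)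
    (((reach_of_highStep hzau).tail hzuv).trans (reach_of_highStep hzvb))
    (hza.1.trans (hle.1.trans hzb.1.symm)) (Set.singleton_nonempty k)
    (Set.disjoint_singleton_right.2 fun hkS => hkS.2 hk) ?_ fun j hj => ?_⟩
  · rintro _ rfl
    exact hlt
  · have := hdriftu j hj
    have := hdriftv j hj
    have := hdriftb j hj
    have : a.2 j ≤ b.2 j := hle.2 j
    omega

theorem le_of_notMem_iUnion (hlt : ∀ j ∈ Y, a.2 j < b.2 j)
    (hle : ∀ j ∉ Y, b.2 j < a.2 j → ∃ l, j ∈ X l) : ∀ j ∉ ⋃ l, X l, a.2 j ≤ b.2 j := by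
  intro j hjX
  by_cases hjY : j ∈ Y
  · exact (hlt j hjY).le
  · exact not_lt.1 fun hj => hjX (Set.mem_iUnion.2 (hle j hjY hj))

theorem LoopChain.accelerated (h : W.LoopChain c₀ X c) :
    W.Accelerated ∅ c₀ (⋃ l, X l) (freeze (⋃ l, X l) c) := by
  induction h with
  | nil X =>
    rw [Set.iUnion_of_empty]
    exact .init
  | @loop K X Y c a b _ hca hab hst hY hdisj hlt hle ih =>
    have hYX : ∀ j ∈ Y, j ∉ ⋃ l, X l := fun j hj hjX =>
      Set.disjoint_left.1 (Set.disjoint_iUnion_left.2 hdisj) hjX hj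
    have hloop := ih.loop (reach_freeze hca _) (reach_freeze hab _)
      (coveredBy_freeze hst (le_of_notMem_iUnion hlt hle)) hY fun j hj => by
        rw [freeze_of_notMem (hYX j hj), freeze_of_notMem (hYX j hj)]
        exact hlt j hj
    rwa [freeze_freeze Set.subset_union_left, ← iUnion_snoc] at hloop

theorem LoopChain.exists_pumped {X : Fin (K + 1) → Set (Fin n)} (h : W.LoopChain c₀ X c)
    {i k : Fin n} (hi : ∃ l : Fin K, i ∈ X l.castSucc) (hk : k ∈ X (Fin.last K)) (T N : ℕ) :
    ∃ z z', ReflTransGen W.Step c₀ z ∧ ReflTransGen (W.HighStep {i} T) z z' ∧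
      z.2 k + N ≤ z'.2 k := by
  obtain ⟨l, hi⟩ := hi
  cases h with
  | @loop _ X Y c₁ a _ hc hca hab hst _ hdisj hlt hle =>
    rw [Fin.snoc_castSucc] at hi
    rw [Fin.snoc_last] at hk
    have hiS : i ∈ (⋃ l, X l) \ ∅ := ⟨Set.mem_iUnion.2 ⟨l, hi⟩, Set.notMem_empty i⟩
    have hkS : k ∉ ⋃ l, X l := fun hkX =>
      Set.disjoint_left.1 (Set.disjoint_iUnion_left.2 hdisj) hkX hk
    have hempty : W.IsNondecreasing ∅ := fun _ _ _ hj => absurd hj (Set.notMem_empty _)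
    obtain ⟨T₁, hT₁⟩ := exists_highSteps_iterate (reach_freeze hab _)
      (coveredBy_freeze hst (le_of_notMem_iUnion hlt hle)) hempty N T
    obtain ⟨T₂, hT₂⟩ := exists_highSteps (reach_freeze hca _) hempty T₁
    obtain ⟨_, _, z, hz, -, hzc⟩ := hc.accelerated.exists_loopChain hempty T₂
    obtain ⟨z₁, hzz₁, hz₁, -⟩ := hT₂ z hzc
    obtain ⟨z₂, hz₁z₂, -, hdrift⟩ := hT₁ z₁ hz₁
    refine ⟨z₁, z₂, hz.reach.trans (reach_of_highStep hzz₁), ReflTransGen.mono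
      (fun _ _ h => h.mono (Set.singleton_subset_iff.2 hiS) le_rfl) _ _ hz₁z₂, ?_⟩
    have hpump := hdrift k hkS
    rw [freeze_of_notMem hkS, freeze_of_notMem hkS] at hpump
    have := Nat.mul_le_mul_left N (Nat.succ_le_of_lt (hlt k hk))
    rw [Nat.mul_succ] at this
    omega

end LoopChains

section PumpableRuns

variable {P : Type*} {n K : ℕ} {W : VASS P n} {X : Fin K → Set (Fin n)} {c₀ c : Config P n}

theorem IsRun.reach {L : ℕ} {ρ : Fin (L + 1) → Config P n} (hρ : W.IsRun ρ) {k l : Fin (L + 1)}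
    (hkl : k ≤ l) : ReflTransGen W.Step (ρ k) (ρ l) := by
  induction l using Fin.induction with
  | zero => rw [Fin.le_zero_iff.1 hkl]
  | succ l ih =>
    rcases hkl.lt_or_eq with hlt | rfl
    · exact (ih (Fin.le_castSucc_iff.2 hlt)).tail (hρ l)
    · exact .refl

theorem SatisfiesPB.exists_loopChain {L : ℕ} {ρ : Fin (L + 1) → Config P n}
    (h : SatisfiesPB X ρ) (hX : IsDisjointnessSeq X) (hρ : W.IsRun ρ) :
    ∃ c, W.LoopChain (ρ 0) X c := by
  obtain ⟨p, hp, hp0, -, hst, hlt, hle⟩ := h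
  suffices hprefix : ∀ k (hk : k ≤ K),
      W.LoopChain (ρ 0) (fun l => X (Fin.castLE hk l)) (ρ (p ⟨2 * k, by omega⟩)) from
    ⟨_, hprefix K le_rfl⟩
  intro k hk
  induction k with
  | zero => exact hp0 ▸ .nil _
  | succ k ih =>
    let l : Fin K := ⟨k, hk⟩
    have hpre : (⟨2 * k, by omega⟩ : Fin (2 * K + 1)) ≤ startIdx l := Nat.le_succ _
    have hseg : startIdx l ≤ stopIdx l := Nat.le_succ _
    have hloop := (ih (by omega)).loop (hρ.reach (hp hpre)) (hρ.reach (hp hseg)) (hst l)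
      (hX.nonempty l) (fun m => hX.disjoint _ _ (Fin.ne_of_lt m.isLt)) (hlt l) fun j hj hj' =>
        let ⟨m, hm, hjm⟩ := hle l j hj hj'
        ⟨⟨m, hm⟩, hjm⟩
    exact Fin.snoc_init_self (α := fun _ => Set (Fin n)) (fun m => X (Fin.castLE hk m)) ▸ hloop

theorem LoopChain.exists_cutPoints (h : W.LoopChain c₀ X c) :
    ∃ d : ℕ → Config P n, d 0 = c₀ ∧ (∀ k, ReflTransGen W.Step (d k) (d (k + 1))) ∧
      (∀ k ≥ 2 * K, d k = c) ∧
      ∀ l : Fin K, (d (2 * l + 1)).1 = (d (2 * l + 2)).1 ∧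
        (∀ j ∈ X l, (d (2 * l + 1)).2 j < (d (2 * l + 2)).2 j) ∧
        ∀ j ∉ X l, (d (2 * l + 2)).2 j < (d (2 * l + 1)).2 j → ∃ l' < l, j ∈ X l' := by
  induction h with
  | nil => exact ⟨fun _ => c₀, rfl, fun _ => .refl, fun _ _ => rfl, fun l => l.elim0⟩
  | @loop K X Y c a b _ hca hab hst _ _ hlt hle ih =>
    obtain ⟨d, hd0, hd, hdc, hdX⟩ := ih
    let e : ℕ → Config P n := fun k => if k = 0 then c else if k = 1 then a else b
    have hde : d (2 * K) = e 0 := hdc _ le_rfl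
    have he : ∀ k, ReflTransGen W.Step (e k) (e (k + 1))
      | 0 => hca
      | 1 => hab
      | _ + 2 => .refl
    have hlate (k : ℕ) : splice d (2 * K) e (2 * K + k) = e k := splice_add hde k
    refine ⟨splice d (2 * K) e, (splice_of_le (Nat.zero_le _)).trans hd0, fun k => ?_,
      fun k hk => ?_, Fin.forall_fin_succ'.2 ⟨fun l => ?_, ?_⟩⟩
    · rcases lt_or_ge k (2 * K) with hk | hk
      · rw [splice_of_le hk.le, splice_of_le hk]
        exact hd k
      · obtain ⟨m, rfl⟩ := Nat.exists_eq_add_of_le hk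
        rw [Nat.add_assoc, hlate, hlate]
        exact he m
    · obtain ⟨m, rfl⟩ := Nat.exists_eq_add_of_le hk
      rw [Nat.mul_succ, Nat.add_assoc, hlate]
      exact (if_neg (by omega)).trans (if_neg (by omega))
    · simp only [Fin.snoc_castSucc, Fin.val_castSucc,
        splice_of_le (show 2 * l.val + 1 ≤ 2 * K by omega),
        splice_of_le (show 2 * l.val + 2 ≤ 2 * K by omega)]
      refine ⟨(hdX l).1, (hdX l).2.1, fun j hj hj' => ?_⟩
      obtain ⟨m, hm, hjm⟩ := (hdX l).2.2 j hj hj'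
      exact ⟨m.castSucc, Fin.castSucc_lt_castSucc_iff.2 hm, by rwa [Fin.snoc_castSucc]⟩
    · simp only [Fin.snoc_last, Fin.val_last, hlate]
      refine ⟨hst, hlt, fun j hj hj' => ?_⟩
      obtain ⟨m, hjm⟩ := hle j hj hj'
      exact ⟨m.castSucc, Fin.castSucc_lt_last m, by rwa [Fin.snoc_castSucc]⟩

theorem LoopChain.exists_satisfiesPB (h : W.LoopChain c₀ X c) :
    ∃ (L : ℕ) (ρ : Fin (L + 1) → Config P n), ρ 0 = c₀ ∧ W.IsRun ρ ∧ SatisfiesPB X ρ := by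
  obtain ⟨d, hd0, hd, -, hdX⟩ := h.exists_cutPoints
  obtain ⟨p, hp, hp0, hpath⟩ := exists_isPath_through hd
  obtain ⟨ρ, hρ, hρd⟩ := hpath (2 * K)
  have hbound (k : Fin (2 * K + 1)) : p k < p (2 * K) + 1 :=
    Nat.lt_succ_of_le (hp (Nat.le_of_lt_succ k.isLt))
  have hcut (k : Fin (2 * K + 1)) : ρ (p k) = d k := hρd k (Nat.le_of_lt_succ k.isLt)
  refine ⟨p (2 * K), fun k => ρ k, ?_, fun k => hρ k k.isLt, fun k => ⟨p k, hbound k⟩,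
    fun k l hkl => hp hkl, Fin.ext hp0, rfl, ?_, ?_, ?_⟩
  · exact (congrArg ρ hp0).symm.trans ((hcut 0).trans hd0)
  all_goals
    simp only [hcut]
  · exact fun l => (hdX l).1
  · exact fun l => (hdX l).2.1
  · exact fun l => (hdX l).2.2

theorem LoopChain.nonempty (h : W.LoopChain c₀ X c) (l : Fin K) : (X l).Nonempty := by
  induction h with
  | nil => exact l.elim0
  | loop _ _ _ _ hY _ _ _ ih =>
    refine l.lastCases ?_ fun l => ?_
    · rwa [Fin.snoc_last]
    · rw [Fin.snoc_castSucc]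
      exact ih l

theorem LoopChain.disjoint (h : W.LoopChain c₀ X c) {l l' : Fin K} (hl : l < l') :
    Disjoint (X l) (X l') := by
  induction h with
  | nil => exact l.elim0
  | loop _ _ _ _ _ hdisj _ _ ih =>
    obtain ⟨l, rfl⟩ := Fin.exists_castSucc_eq.2 (Fin.ne_last_of_lt hl)
    rw [Fin.snoc_castSucc]
    induction l' using Fin.lastCases with
    | last =>
      rw [Fin.snoc_last]
      exact hdisj l
    | cast l' =>
      rw [Fin.snoc_castSucc]
      exact ih (Fin.castSucc_lt_castSucc_iff.1 hl)

theorem LoopChain.isDisjointnessSeq (h : W.LoopChain c₀ X c) (hK : 0 < K) :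
    IsDisjointnessSeq X where
  length_pos := hK
  nonempty := h.nonempty
  disjoint _ _ hl := hl.lt_or_gt.elim h.disjoint fun hl => (h.disjoint hl).symm

end PumpableRuns

section ReversalCounting

variable {Q : Type*} {n : ℕ} {V : VASS Q n} {B : ℕ} {i : Fin n}
  {y y' z z' : Config (Q × (Fin n → Mode)) (n + n)}

theorem RevCond.eq_or_ne {b e : ℤ} {m m' : Mode} (h : RevCond b m m' e) :
    m = m' ∧ e = 0 ∨ m ≠ m' ∧ e = 1 := by
  rcases h with ⟨-, rfl, rfl, rfl⟩ | ⟨-, rfl, rfl, rfl⟩ | ⟨-, rfl, rfl, rfl⟩ |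
    ⟨-, rfl, rfl, rfl⟩ | ⟨-, rfl, rfl⟩ <;> simp

theorem weakRevCond_iff {x : ℕ} {b e : ℤ} {m m' : Mode} :
    WeakRevCond B x b m m' e ↔ ∃ e', RevCond b m m' e' ∧ e = if B < x then e' else 0 := by
  constructor
  · rintro (⟨hb, rfl, rfl, rfl⟩ | ⟨hb, rfl, rfl, hx, rfl⟩ | ⟨hb, rfl, rfl, hx, rfl⟩ |
      ⟨hb, rfl, rfl, rfl⟩ | ⟨hb, rfl, rfl, hx, rfl⟩ | ⟨hb, rfl, rfl, hx, rfl⟩ | ⟨hb, rfl, rfl⟩)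
    · exact ⟨0, .inl ⟨hb, rfl, rfl, rfl⟩, (ite_self 0).symm⟩
    · exact ⟨1, .inr (.inl ⟨hb, rfl, rfl, rfl⟩), (if_neg hx.not_gt).symm⟩
    · exact ⟨1, .inr (.inl ⟨hb, rfl, rfl, rfl⟩), (if_pos hx).symm⟩
    · exact ⟨0, .inr (.inr (.inl ⟨hb, rfl, rfl, rfl⟩)), (ite_self 0).symm⟩
    · exact ⟨1, .inr (.inr (.inr (.inl ⟨hb, rfl, rfl, rfl⟩))), (if_pos hx).symm⟩
    · exact ⟨1, .inr (.inr (.inr (.inl ⟨hb, rfl, rfl, rfl⟩))), (if_neg hx.not_gt).symm⟩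
    · exact ⟨0, .inr (.inr (.inr (.inr ⟨hb, rfl, rfl⟩))), (ite_self 0).symm⟩
  · rintro ⟨e', h, rfl⟩
    unfold RevCond at h
    unfold WeakRevCond
    split_ifs <;> grind

theorem tsStep_iff : V.TSStep B y y' ↔ ∃ b : Fin (n + n) → ℤ, (y.1, b, y'.1) ∈ V.rb.trans ∧
    ∀ j, (y'.2 (Fin.castAdd n j) : ℤ) = y.2 (Fin.castAdd n j) + b (Fin.castAdd n j) ∧
      (y'.2 (Fin.natAdd n j) : ℤ) = y.2 (Fin.natAdd n j) +
        if B < y.2 (Fin.castAdd n j) then b (Fin.natAdd n j) else 0 := by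
  constructor
  · rintro ⟨b', b, hb, hcast, hrev, h⟩
    choose e he hbe using fun j => weakRevCond_iff.1 (hrev j)
    refine ⟨Fin.append b e, ⟨b, hb, fun j => Fin.append_left .., fun j => ?_⟩, fun j => ⟨?_, ?_⟩⟩
    · simpa only [Fin.append_right] using he j
    · rw [Fin.append_left, h, hcast]
    · rw [Fin.append_right, h, hbe]
  · rintro ⟨b', ⟨b, hb, hcast, hrev⟩, h⟩
    refine ⟨Fin.append b fun j => if B < y.2 (Fin.castAdd n j) then b' (Fin.natAdd n j) else 0,
      b, hb, fun j => Fin.append_left .., fun j => ?_, fun k => ?_⟩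
    · simpa only [Fin.append_right] using weakRevCond_iff.2 ⟨_, hrev j, rfl⟩
    · refine k.addCases (fun j => ?_) fun j => ?_
      · rw [Fin.append_left, (h j).1, ← hcast]
      · rw [Fin.append_right, (h j).2]

/-- The components of `V_rb` that count reversals. -/
def counters (n : ℕ) : Set (Fin (n + n)) :=
  Set.range (Fin.natAdd n)

theorem natAdd_mem_counters (i : Fin n) : Fin.natAdd n i ∈ counters n :=
  ⟨i, rfl⟩

theorem castAdd_notMem_counters (i : Fin n) : Fin.castAdd n i ∉ counters n := by
  rintro ⟨j, hj⟩
  have := congrArg Fin.val hj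
  simp only [Fin.val_natAdd, Fin.val_castAdd] at this
  omega

theorem exists_castAdd_eq {j : Fin (n + n)} (hj : j ∉ counters n) : ∃ i, j = Fin.castAdd n i :=
  j.addCases (fun i _ => ⟨i, rfl⟩) (fun i hi => absurd (natAdd_mem_counters i) hi) hj

/-- A transition between these control states of `V_rb` reverses the component `i`. -/
def IsReversal (i : Fin n) (p p' : Q × (Fin n → Mode)) : Prop :=
  p.2 i ≠ p'.2 i

theorem rb_trans_natAdd {p p' : Q × (Fin n → Mode)} {b : Fin (n + n) → ℤ}
    (h : (p, b, p') ∈ V.rb.trans) (i : Fin n) :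
    ¬ IsReversal i p p' ∧ b (Fin.natAdd n i) = 0 ∨ IsReversal i p p' ∧ b (Fin.natAdd n i) = 1 := by
  obtain ⟨_, _, _, h⟩ := h
  exact (h i).eq_or_ne.imp_left (And.imp_left not_not_intro)

theorem isNondecreasing_counters (V : VASS Q n) : V.rb.IsNondecreasing (counters n) := by
  rintro ⟨p, b, p'⟩ ht _ ⟨i, rfl⟩
  rcases rb_trans_natAdd ht i with ⟨-, h⟩ | ⟨-, h⟩ <;> simp only [h] <;> decide

theorem Step.lt_of_isReversal (h : V.rb.Step z z') (hi : IsReversal i z.1 z'.1) :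
    z.2 (Fin.natAdd n i) < z'.2 (Fin.natAdd n i) := by
  obtain ⟨b, hb, h⟩ := h
  have h1 := ((rb_trans_natAdd hb i).resolve_left fun h => h.1 hi).2
  have := h (Fin.natAdd n i)
  omega

theorem TSStep.frozenStep (h : V.TSStep B y y') :
    V.rb.FrozenStep (counters n) (freeze (counters n) y) (freeze (counters n) y') := by
  obtain ⟨b, hb, h⟩ := tsStep_iff.1 h
  refine frozenStep_freeze_iff.2 ⟨b, hb, fun j hj => ?_⟩
  obtain ⟨i, rfl⟩ := exists_castAdd_eq hj
  exact (h i).1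

theorem TSStep.le_add_one (h : V.TSStep B y y') (i : Fin n) :
    y'.2 (Fin.natAdd n i) ≤ y.2 (Fin.natAdd n i) + 1 := by
  obtain ⟨b, hb, h⟩ := tsStep_iff.1 h
  have h1 := rb_trans_natAdd hb i
  have h2 := (h i).2
  split_ifs at h2 <;> omega

theorem TSStep.le_of_not_highMark (h : V.TSStep B y y')
    (hm : ¬ HighMark (IsReversal i) (Fin.castAdd n i) (counters n) B
      (freeze (counters n) y) (freeze (counters n) y')) :
    y'.2 (Fin.natAdd n i) ≤ y.2 (Fin.natAdd n i) := by
  obtain ⟨b, hb, h⟩ := tsStep_iff.1 h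
  have h2 := (h i).2
  split_ifs at h2 with hB
  · have hnot : ¬ IsReversal i y.1 y'.1 := fun hi =>
      hm ⟨hi, .inr (by rwa [freeze_of_notMem (castAdd_notMem_counters i)])⟩
    have := ((rb_trans_natAdd hb i).resolve_right fun h => hnot h.1).2
    omega
  · omega

theorem exists_tsStep (h : V.rb.Step z z') (hy : freeze (counters n) y = freeze (counters n) z)
    (B : ℕ) : ∃ y', freeze (counters n) y' = freeze (counters n) z' ∧ V.TSStep B y y' ∧
      ∀ i, B < z.2 (Fin.castAdd n i) →
        y'.2 (Fin.natAdd n i) + z.2 (Fin.natAdd n i) =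
          z'.2 (Fin.natAdd n i) + y.2 (Fin.natAdd n i) := by
  obtain ⟨b, hb, h⟩ := h
  obtain ⟨hst, hval⟩ := freeze_eq_freeze_iff.1 hy
  have hval (j : Fin n) : y.2 (Fin.castAdd n j) = z.2 (Fin.castAdd n j) :=
    hval _ (castAdd_notMem_counters j)
  have hcount (j : Fin n) : ((b (Fin.natAdd n j)).toNat : ℤ) = b (Fin.natAdd n j) :=
    Int.toNat_of_nonneg (isNondecreasing_counters V _ hb _ (natAdd_mem_counters j))
  refine ⟨(z'.1, Fin.append (fun j => z'.2 (Fin.castAdd n j)) fun j => y.2 (Fin.natAdd n j) +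
    if B < z.2 (Fin.castAdd n j) then (b (Fin.natAdd n j)).toNat else 0),
    freeze_eq_freeze_iff.2 ⟨rfl, fun j hj => ?_⟩,
    tsStep_iff.2 ⟨b, hst ▸ hb, fun j => ⟨?_, ?_⟩⟩, fun i hi => ?_⟩
  · obtain ⟨i, rfl⟩ := exists_castAdd_eq hj
    simp only [Fin.append_left]
  · simp only [Fin.append_left, hval, h]
  · simp only [Fin.append_right, hval, Nat.cast_add, Nat.cast_ite, hcount, Nat.cast_zero]
  · have := h (Fin.natAdd n i)
    have := hcount i
    simp only [Fin.append_right, if_pos hi]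
    omega

theorem exists_tsStep_reach (h : ReflTransGen V.rb.Step z z')
    (hy : freeze (counters n) y = freeze (counters n) z) (B : ℕ) :
    ∃ y', freeze (counters n) y' = freeze (counters n) z' ∧ ReflTransGen (V.TSStep B) y y' := by
  induction h with
  | refl => exact ⟨y, hy, .refl⟩
  | tail _ h ih =>
    obtain ⟨y₁, hy₁, hyy₁⟩ := ih
    obtain ⟨y₂, hy₂, hy₁y₂, -⟩ := exists_tsStep h hy₁ B
    exact ⟨y₂, hy₂, hyy₁.tail hy₁y₂⟩

theorem exists_tsStep_reach_of_high
    (h : ReflTransGen (V.rb.HighStep {Fin.castAdd n i} (B + 1)) z z')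
    (hy : freeze (counters n) y = freeze (counters n) z) :
    ∃ y', freeze (counters n) y' = freeze (counters n) z' ∧ ReflTransGen (V.TSStep B) y y' ∧
      y'.2 (Fin.natAdd n i) + z.2 (Fin.natAdd n i) =
        z'.2 (Fin.natAdd n i) + y.2 (Fin.natAdd n i) := by
  induction h with
  | refl => exact ⟨y, hy, .refl, Nat.add_comm ..⟩
  | tail _ h ih =>
    obtain ⟨y₁, hy₁, hyy₁, hdrift₁⟩ := ih
    obtain ⟨y₂, hy₂, hy₁y₂, hdrift₂⟩ := exists_tsStep h.1 hy₁ B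
    have := hdrift₂ i (h.2 _ rfl)
    exact ⟨y₂, hy₂, hyy₁.tail hy₁y₂, by omega⟩

theorem not_weaklyReversalBoundedWrt_iff {c : Config Q n} :
    ¬ V.WeaklyReversalBoundedWrt c i ↔
      ∀ B N, ∃ d, ReflTransGen (V.TSStep B) (rbInit c) d ∧ N ≤ d.2 (Fin.natAdd n i) := by
  rw [WeaklyReversalBoundedWrt, not_exists]
  refine forall_congr' fun B => ⟨fun h N => ?_, fun h => ?_⟩
  · obtain ⟨_, ⟨d, hd, rfl⟩, hN⟩ := Set.Infinite.exists_gt h N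
    exact ⟨d, hd, hN.le⟩
  · refine Set.infinite_of_forall_exists_gt fun N => ?_
    obtain ⟨d, hd, hN⟩ := h (N + 1)
    exact ⟨_, ⟨d, hd, rfl⟩, hN⟩

theorem rbInit_natAdd (c : Config Q n) (i : Fin n) : (rbInit c).2 (Fin.natAdd n i) = 0 := by
  simp only [rbInit, Fin.append_right]

theorem rich_rbInit {c : Config Q n} (h : ¬ V.WeaklyReversalBoundedWrt c i) :
    Rich (V.rb.FrozenStep (counters n)) (HighMark (IsReversal i) (Fin.castAdd n i) (counters n))
      (freeze (counters n) (rbInit c)) := by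
  intro N
  obtain ⟨d, hd, hN⟩ := not_weaklyReversalBoundedWrt_iff.1 h N N
  obtain ⟨ρ, L, hρ, h0, rfl⟩ := exists_isPath hd
  refine ⟨L, fun k => freeze (counters n) (ρ k), congrArg _ h0,
    fun k hk => (hρ k hk).frozenStep, hN.trans ?_⟩
  have hle := hρ.le_add_markCount (f := fun y => y.2 (Fin.natAdd n i))
    (fun _ _ h => h.le_add_one i) fun _ _ h => h.le_of_not_highMark
  rwa [h0, rbInit_natAdd, Nat.zero_add] at hle

theorem exists_loopChain_of_not_weaklyReversalBoundedWrt {c : Config Q n}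
    (h : ¬ V.WeaklyReversalBoundedWrt c i) :
    ∃ (K : ℕ) (X : Fin (K + 1) → Set (Fin (n + n))) (z : Config (Q × (Fin n → Mode)) (n + n)),
      Fin.natAdd n i ∈ X (Fin.last K) ∧ (∃ l : Fin K, Fin.castAdd n i ∈ X l.castSucc) ∧
        V.rb.LoopChain (rbInit c) X z := by
  obtain ⟨S, c, a, b, hc, hiS, hca, hle, hab⟩ := Accelerated.init.exists_loop (rich_rbInit h)
  obtain ⟨K, X, z, hX, hz⟩ := hc.exists_loopChain_snoc (isNondecreasing_counters V)
    (natAdd_mem_counters i) (fun _ _ => Step.lt_of_isReversal) hca hle hab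
  obtain ⟨l, hl⟩ := Set.mem_iUnion.1 (hX.ge ⟨hiS, castAdd_notMem_counters i⟩)
  exact ⟨K, Fin.snoc X {Fin.natAdd n i}, z, by rw [Fin.snoc_last]; exact rfl,
    ⟨l, by rwa [Fin.snoc_castSucc]⟩, hz⟩

theorem LoopChain.not_weaklyReversalBoundedWrt {c : Config Q n} {K : ℕ}
    {X : Fin (K + 1) → Set (Fin (n + n))} (h : V.rb.LoopChain (rbInit c) X z)
    (hlast : Fin.natAdd n i ∈ X (Fin.last K)) (hi : ∃ l : Fin K, Fin.castAdd n i ∈ X l.castSucc) :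
    ¬ V.WeaklyReversalBoundedWrt c i := by
  refine not_weaklyReversalBoundedWrt_iff.2 fun B N => ?_
  obtain ⟨z₁, z₂, hz₁, hz₁z₂, hN⟩ := h.exists_pumped hi hlast (B + 1) N
  obtain ⟨y₁, hyz₁, hy₁⟩ := exists_tsStep_reach hz₁ rfl B
  obtain ⟨y₂, -, hy₁y₂, hdrift⟩ := exists_tsStep_reach_of_high hz₁z₂ hyz₁
  exact ⟨y₂, hy₁.trans hy₁y₂, by omega⟩

end ReversalCounting

end VASS

theorem mainTheorem7 {Q : Type*} {n : ℕ} (V : VASS Q n) (q : Q) (x : Fin n → ℕ) (i : Fin n) :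
    ¬ V.WeaklyReversalBoundedWrt (q, x) i ↔
      ∃ (K : ℕ) (X : Fin (K + 1) → Set (Fin (n + n))),
        VASS.IsDisjointnessSeq X ∧
        Fin.natAdd n i ∈ X (Fin.last K) ∧
        (∃ l : Fin K, Fin.castAdd n i ∈ X l.castSucc) ∧
        ∃ (L : ℕ) (ρ : Fin (L + 1) → VASS.Config (Q × (Fin n → VASS.Mode)) (n + n)),
          ρ 0 = VASS.rbInit (q, x) ∧ V.rb.IsRun ρ ∧ VASS.SatisfiesPB X ρ := by
  constructor
  · intro h
    obtain ⟨K, X, z, hlast, hi, hz⟩ := VASS.exists_loopChain_of_not_weaklyReversalBoundedWrt h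
    exact ⟨K, X, hz.isDisjointnessSeq K.succ_pos, hlast, hi, hz.exists_satisfiesPB⟩
  · rintro ⟨K, X, hX, hlast, hi, L, ρ, h0, hρ, hPB⟩
    obtain ⟨z, hz⟩ := hPB.exists_loopChain hX hρ
    exact (h0 ▸ hz).not_weaklyReversalBoundedWrt hlast hi
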